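/- Let $G$ be an embedded graph, that is, a finite graph (not necessarily connected; loops, multiple edges and isolated vertices are allowed) cellularly embedded in a closed, not necessarily orientable or connected, surface, or equivalently a ribbon graph, or equivalently an arrow presentation. For $A\subseteq E(G)$ let $c(A)$ be the number of connected components and $f(A)$ the number of boundary components of the spanning ribbon subgraph $(V(G),A)$, and put $r(A)=|V(G)|-c(A)$ and $n(A)=|A|-r(A)$; write $c(G)=c(E(G))$, $r(G)=r(E(G))$ and $f(G)=f(E(G))$ (the number of faces of $G$). The ribbon graph (Bollobás–Riordan) polynomial of $G$ is $$R(G;x,y,z)=\sum_{A\subseteq E(G)}(x-1)^{r(G)-r(A)}\,y^{n(A)}\,z^{c(A)-f(A)+n(A)}\in\mathbb Z[x,y,z].$$ For $A\subseteq E(G)$ the partial Petrial $G^{\tau(A)}$ is obtained by adding a half-twist to every edge in $A$ (in an arrow presentation: by reversing exactly one of the two arrows of each label in $A$), $G^{\times}=G^{\tau(E(G))}$ is the Petrie dual of $G$, and $G^{*}$ is its geometric dual. The Penrose polynomial of $G$ is $$P(G;\lambda)=\sum_{A\subseteq E(G)}(-1)^{|A|}\lambda^{f(G^{\tau(A)})}\in\mathbb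 Z[\lambda].$$ **Theorem 4.6.** For every embedded graph $G$, $$P(G^{*};\lambda)=\lambda^{c(G^{\times})}\,(-1)^{r(G^{\times})}\,R\bigl(G^{\times};\,1-\lambda,\,-\lambda,\,1/\lambda\bigr).$$ This is an identity in $\mathbb Z[\lambda,\lambda^{-1}]$; equivalently, it holds for every invertible element $\lambda$ of every commutative ring. -/

import Mathlib

/-- The four corners of each edge disc.  The corner `(e, i, t)` is an end point of the `i`-th of the
two `e`-labelled marking arrows: its tip if `t = true`, its tail if `t = false`. -/
abbrev Corner (E : Type*) := E × Bool × Bool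

namespace Corner

variable {E : Type*}

/-- The other end of the same marking arrow. -/
def across (c : Corner E) : Corner E := (c.1, c.2.1, !c.2.2)

/-- The other end of the same side of the edge disc.  The boundary of the edge disc is oriented
consistently with both of its arrows, hence its two sides run from the tip of one arrow to
the tail of the other one. -/
def side (c : Corner E) : Corner E := (c.1, !c.2.1, !c.2.2)

/-- Reversal of the direction of exactly one of the two `e`-labelled arrows, for each `e ∈ A`. -/
noncomputable def flip (A : Set E) : Equiv.Perm (Corner E) :=
  open Classical in
  Function.Involutive.toPerm
    (fun c => if c.1 ∈ A ∧ c.2.1 = true then across c else c)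
    (by
      rintro ⟨e, i, t⟩
      by_cases h : e ∈ A <;> cases i <;> simp [across, h])

/-- The sides of an edge disc, oriented consistently with its boundary, as a new pair of arrows:
the new `i`-th arrow runs from the tip of the old `i`-th arrow to the tail of the other old arrow.
The map takes a corner named by means of the new arrows to its name by means of the old ones. -/
def rotate (E : Type*) : Equiv.Perm (Corner E) where
  toFun c := (c.1, xor c.2.1 c.2.2, !c.2.2)
  invFun c := (c.1, xor c.2.1 (!c.2.2), !c.2.2)
  left_inv := by rintro ⟨e, i, t⟩; cases i <;> cases t <;> rfl
  right_inv := by rintro ⟨e, i, t⟩; cases i <;> cases t <;> rfl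

end Corner

/-- An embedded graph with vertex set `V` and edge set `E`, given by an arrow presentation: a set `V`
of circles (the boundaries of the vertex discs), carrying disjoint marking arrows, exactly two with
each label `e : E`.  The arrows cut the circles that carry arrows into arcs, each of which joins two
ends of arrows; `arc` takes an arrow end to the other end of the arc that starts there.  Two arrow ends
lie on the same circle if and only if one gets from one to the other along arcs and arrows.
Circles without arrows (isolated vertices) are the elements of `V` outside the range of `vertex`. -/
structure EmbeddedGraph (V E : Type*) where
  arc : Corner E → Corner E
  arc_arc : ∀ c, arc (arc c) = c
  arc_ne : ∀ c, arc c ≠ c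
  /-- The circle on which an arrow end lies. -/
  vertex : Corner E → V
  vertex_eq_iff : ∀ c d, vertex c = vertex d ↔
    Relation.EqvGen (fun x y => y = arc x ∨ y = Corner.across x) c d

theorem Relation.eqvGen_comap_equiv {α : Type*} (φ : Equiv.Perm α) {r s : α → α → Prop}
    (h : ∀ x y, s x y ↔ r (φ x) (φ y)) (x y : α) :
    Relation.EqvGen s x y ↔ Relation.EqvGen r (φ x) (φ y) := by
  constructor
  · intro H
    induction H with
    | rel x y hxy => exact .rel _ _ ((h x y).1 hxy)
    | refl x => exact .refl _
    | symm x y _ ih => exact .symm _ _ ih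
    | trans x y z _ _ ih1 ih2 => exact .trans _ _ _ ih1 ih2
  · intro H
    have key : ∀ a b, Relation.EqvGen r a b → Relation.EqvGen s (φ.symm a) (φ.symm b) := by
      intro a b H
      induction H with
      | rel x y hxy => exact .rel _ _ ((h _ _).2 (by simpa using hxy))
      | refl x => exact .refl _
      | symm x y _ ih => exact .symm _ _ ih
      | trans x y z _ _ ih1 ih2 => exact .trans _ _ _ ih1 ih2
    simpa using key _ _ H

namespace EmbeddedGraph

variable {V E : Type*} (G : EmbeddedGraph V E)

/-- The partial Petrial `G^{τ(A)}`: for each `e ∈ A`, reverse the direction of exactly one of the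
two `e`-labelled arrows, i.e. exchange the names of its tip and of its tail. -/
noncomputable def partialPetrial (A : Set E) : EmbeddedGraph V E where
  arc c := (Corner.flip A).symm (G.arc (Corner.flip A c))
  arc_arc c := by simp [G.arc_arc]
  arc_ne c h := G.arc_ne (Corner.flip A c) ((Equiv.symm_apply_eq _).1 h)
  vertex c := G.vertex (Corner.flip A c)
  vertex_eq_iff c d := by
    rw [G.vertex_eq_iff]
    refine (Relation.eqvGen_comap_equiv _ (fun x y => ?_) c d).symm
    refine or_congr (Equiv.eq_symm_apply _) ?_
    rw [← (Corner.flip A).apply_eq_iff_eq]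
    refine Eq.congr rfl ?_
    obtain ⟨e, i, t⟩ := x
    by_cases h : e ∈ A <;> cases i <;> simp [Corner.flip, Corner.across, h]

/-- The Petrie dual `G^×`. -/
noncomputable def petrial : EmbeddedGraph V E := G.partialPetrial Set.univ

/-- One step along the boundary of the spanning ribbon subgraph `(V(G), A)`: follow an arc of a vertex
circle, or a side of an edge disc that belongs to `A`, or that part of a vertex circle to which an
edge disc outside `A` was attached. -/
def BoundaryStep (A : Set E) (c d : Corner E) : Prop :=
  d = G.arc c ∨ (c.1 ∈ A ∧ d = Corner.side c) ∨ (c.1 ∉ A ∧ d = Corner.across c)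

/-- The boundary components of the spanning ribbon subgraph `(V(G), A)`; a vertex circle without arrows
is a boundary component of its own. -/
abbrev BoundaryComponent (A : Set E) :=
  Quot (G.BoundaryStep A) ⊕ {v : V // ∀ c, G.vertex c ≠ v}

/-- The faces of `G`. -/
abbrev Face := G.BoundaryComponent Set.univ

/-- The geometric dual `G^*`: its vertices are the discs that are glued to the boundary components of `G`,
its edge discs are those of `G`, now attached along the other two arcs of their boundary. -/
def dual : EmbeddedGraph G.Face E where
  arc c := (Corner.rotate E).symm (G.arc (Corner.rotate E c))
  arc_arc c := by simp [G.arc_arc]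
  arc_ne c h := G.arc_ne (Corner.rotate E c) ((Equiv.symm_apply_eq _).1 h)
  vertex c := Sum.inl (Quot.mk _ (Corner.rotate E c))
  vertex_eq_iff c d := by
    rw [Sum.inl.injEq, Quot.eq]
    refine (Relation.eqvGen_comap_equiv _ (fun x y => ?_) c d).symm
    simp only [BoundaryStep, Set.mem_univ, true_and, not_true_eq_false, false_and, or_false]
    refine or_congr (Equiv.eq_symm_apply _) ?_
    rw [← (Corner.rotate E).apply_eq_iff_eq]
    refine Eq.congr rfl ?_
    obtain ⟨e, i, t⟩ := x
    cases i <;> cases t <;> rfl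

/-- The number `v(G)` of vertices. -/
noncomputable def v (_G : EmbeddedGraph V E) : ℕ := Nat.card V

/-- The number `f(A)` of boundary components of the spanning ribbon subgraph `(V(G), A)`. -/
noncomputable def f (A : Set E) : ℕ := Nat.card (G.BoundaryComponent A)

/-- Two vertices are the two ends of an edge in `A`. -/
def Joined (A : Set E) (u w : V) : Prop :=
  ∃ e ∈ A, (∃ t, G.vertex (e, false, t) = u) ∧ ∃ t, G.vertex (e, true, t) = w

/-- The number `c(A)` of connected components of the spanning subgraph `(V(G), A)`. -/
noncomputable def c (A : Set E) : ℕ := Nat.card (Quot (G.Joined A))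

/-- The rank `r(A) = v(G) - c(A)`. -/
noncomputable def r (A : Set E) : ℕ := G.v - G.c A

/-- The nullity `n(A) = |A| - r(A)`. -/
noncomputable def n (A : Set E) : ℕ := A.ncard - G.r A

/-- The Penrose polynomial `P(G; λ) ∈ ℤ[λ]`. -/
noncomputable def penrose [Fintype E] : Polynomial ℤ :=
  ∑ A : Finset E, (-1) ^ A.card * Polynomial.X ^ (G.partialPetrial (A : Set E)).f Set.univ

/-- The ribbon graph polynomial `R(G; x, y, z) ∈ ℤ[x, y, z]`, with `x, y, z` the variables `0, 1, 2`.
For finite `V` and `E` none of the natural-number subtractions in `r`, `n` and here is truncated: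
a spanning subgraph has at most `v(G)` components, its rank is at most its number of edges and at most
`r(G)`, and `c(A) + n(A) - f(A)` is the Euler genus of `(V(G), A)`. -/
noncomputable def ribbonGraphPolynomial [Fintype E] : MvPolynomial (Fin 3) ℤ :=
  ∑ A : Finset E, (MvPolynomial.X 0 - 1) ^ (G.r Set.univ - G.r (A : Set E)) *
    MvPolynomial.X 1 ^ G.n (A : Set E) *
    MvPolynomial.X 2 ^ (G.c (A : Set E) + G.n (A : Set E) - G.f (A : Set E))

end EmbeddedGraph

/-! The identity holds term by term in `A`. The four corners of an edge disc have three perfect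
matchings: along the arrows (`across`), along the sides (`side`), and the diagonal one. Duality
swaps the first two; a half-twist swaps the last two. Hence the side matching of `(G^*)^{τ(A)}`
becomes, in `G^×`, the side matching at edges of `A` and the arrow matching at all others, which
traces the boundary of the spanning subgraph `A` of `G^×`. This is `f_partialPetrial_dual`.

It remains to compare monomials: the powers of `λ` collapse to `f(A)` and the signs to `(-1)^|A|`.
Since exponents are truncated subtractions, this needs `c(G^×) ≤ c(A)`, `r(A) ≤ |A|` and a
nonnegative Euler genus. The last two follow by adding edges one at a time (`v_le_and_v_add_f_le`):
an edge inside a component raises `f` by at most one, and an edge joining two components lowers `c`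
by one and `f` by at least one. -/

/-- The relation `r` together with the pair `(p, q)`. -/
def addPair {X : Type*} (r : X → X → Prop) (p q : X) : X → X → Prop :=
  fun x y => r x y ∨ (x = p ∧ y = q)

/-! ### Counting classes after adding pairs to a relation -/

section Gluing

variable {X : Type*}

theorem card_quot_congr_eqvGen {r s : X → X → Prop}
    (hrs : ∀ x y, r x y → Relation.EqvGen s x y) (hsr : ∀ x y, s x y → Relation.EqvGen r x y) :
    Nat.card (Quot r) = Nat.card (Quot s) :=
  Nat.card_congr
    { toFun := Quot.lift (Quot.mk s) fun x y h => Quot.eqvGen_sound (hrs x y h)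
      invFun := Quot.lift (Quot.mk r) fun x y h => Quot.eqvGen_sound (hsr x y h)
      left_inv := by rintro ⟨x⟩; rfl
      right_inv := by rintro ⟨x⟩; rfl }

theorem card_quot_addPair_of_eqvGen {r : X → X → Prop} {p q : X} (h : Relation.EqvGen r p q) :
    Nat.card (Quot (addPair r p q)) = Nat.card (Quot r) := by
  refine card_quot_congr_eqvGen ?_ fun x y hxy => .rel _ _ (.inl hxy)
  rintro x y (hxy | ⟨rfl, rfl⟩)
  · exact .rel _ _ hxy
  · exact h

/-- The class of `q` is absorbed by that of `p`, so the old classes other than that of `q` represent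
the new classes exactly once. -/
theorem card_quot_addPair_add_one [Finite X] {r : X → X → Prop} {p q : X}
    (h : ¬ Relation.EqvGen r p q) :
    Nat.card (Quot (addPair r p q)) + 1 = Nat.card (Quot r) := by
  classical
  have hne : Quot.mk r p ≠ Quot.mk r q := fun h' => h (Quot.eqvGen_exact h')
  have e : {a : Quot r // a ≠ Quot.mk r q} ≃ Quot (addPair r p q) :=
    { toFun := fun a => Quot.lift (Quot.mk (addPair r p q)) (fun x y hxy => Quot.sound (.inl hxy)) a.1
      invFun := Quot.lift
        (fun x => if hx : Quot.mk r x = Quot.mk r q then ⟨Quot.mk r p, hne⟩ else ⟨Quot.mk r x, hx⟩)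
        (by
          rintro x y (hxy | ⟨rfl, rfl⟩)
          · simp only [Quot.sound hxy]
          · simp [hne])
      left_inv := by
        rintro ⟨⟨x⟩, hx⟩
        exact dif_neg hx
      right_inv := by
        rintro ⟨x⟩
        by_cases hx : Quot.mk r x = Quot.mk r q
        · simp only [hx, dite_true]
          have h1 : Quot.mk (addPair r p q) x = Quot.mk (addPair r p q) q :=
            congrArg (Quot.lift (Quot.mk (addPair r p q)) fun x y hxy => Quot.sound (.inl hxy)) hx
          have h2 : Quot.mk (addPair r p q) p = Quot.mk (addPair r p q) q :=
            Quot.sound (.inr ⟨rfl, rfl⟩)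
          exact h2.trans h1.symm
        · simp only [hx, dite_false] }
  rw [← Nat.card_congr e]
  have := Nat.card_congr (Equiv.sumCompl (fun a : Quot r => a = Quot.mk r q))
  rw [Nat.card_sum, Nat.card_unique, add_comm] at this
  exact this

theorem card_quot_addPair_le [Finite X] (r : X → X → Prop) (p q : X) :
    Nat.card (Quot (addPair r p q)) ≤ Nat.card (Quot r) := by
  by_cases h : Relation.EqvGen r p q
  · exact (card_quot_addPair_of_eqvGen h).le
  · have := card_quot_addPair_add_one h
    omega

theorem card_quot_le_addPair_add_one [Finite X] (r : X → X → Prop) (p q : X) :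
    Nat.card (Quot r) ≤ Nat.card (Quot (addPair r p q)) + 1 := by
  by_cases h : Relation.EqvGen r p q
  · exact (card_quot_addPair_of_eqvGen h).ge.trans (Nat.le_succ _)
  · exact (card_quot_addPair_add_one h).ge

theorem eqvGen_addPair {r : X → X → Prop} {x y : X} (p q : X) (h : Relation.EqvGen r x y) :
    Relation.EqvGen (addPair r p q) x y :=
  h.mono fun _ _ => Or.inl

theorem eqvGen_of_addPair {r : X → X → Prop} {p q x y : X} (hpq : Relation.EqvGen r p q)
    (h : Relation.EqvGen (addPair r p q) x y) : Relation.EqvGen r x y := by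
  refine (Relation.EqvGen.is_equivalence r).eqvGen_iff.1 (h.mono ?_)
  rintro x y (hxy | ⟨rfl, rfl⟩)
  · exact .rel _ _ hxy
  · exact hpq

/-- Rematching four points changes the number of classes by at most one. -/
theorem card_quot_rematch_le [Finite X] (r : X → X → Prop) (a b c d : X) :
    Nat.card (Quot (addPair (addPair r a d) b c)) ≤
      Nat.card (Quot (addPair (addPair r a b) c d)) + 1 := by
  have h1 := card_quot_le_addPair_add_one r a b
  have h2 := card_quot_le_addPair_add_one (addPair r a b) c d
  have h3 := card_quot_addPair_le r a d
  have h4 := card_quot_addPair_le (addPair r a d) b c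
  by_cases had : Relation.EqvGen r a d
  · by_cases hbc : Relation.EqvGen r b c
    -- With `a ~ d` and `b ~ c` already in `r`, adding `a ~ b` forces `c ~ d`, so the second pair
    -- merges nothing.
    · have hab : Relation.EqvGen (addPair r a b) a b := .rel _ _ (.inr ⟨rfl, rfl⟩)
      have hcd : Relation.EqvGen (addPair r a b) c d :=
        ((eqvGen_addPair a b hbc).symm _ _).trans _ _ _
          ((hab.symm _ _).trans _ _ _ (eqvGen_addPair a b had))
      have := card_quot_addPair_of_eqvGen hcd
      omega
    · have := card_quot_addPair_add_one fun h => hbc (eqvGen_of_addPair had h)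
      omega
  · have := card_quot_addPair_add_one had
    omega

end Gluing

theorem even_card_of_involutive {X : Type*} [DecidableEq X] (s : Finset X) (σ : X → X)
    (hs : ∀ x ∈ s, σ x ∈ s) (hσ : ∀ x ∈ s, σ (σ x) = x) (hne : ∀ x ∈ s, σ x ≠ x) :
    Even s.card := by
  have h : ∑ x ∈ s, (1 : ZMod 2) = 0 :=
    Finset.sum_involution (fun x _ => σ x) (fun _ _ => by decide) (fun x hx _ => hne x hx)
      (fun x hx => hs x hx) (fun x hx => hσ x hx)
  rw [Finset.sum_const, nsmul_one] at h
  exact (ZMod.natCast_eq_zero_iff_even).1 h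

/-! ### Effect of one edge on boundary and connected components -/

namespace EmbeddedGraph

variable {V E : Type*} (G : EmbeddedGraph V E)

theorem vertex_arc (c : Corner E) : G.vertex (G.arc c) = G.vertex c :=
  ((G.vertex_eq_iff _ _).2 (.rel _ _ (.inl rfl))).symm

theorem vertex_across (c : Corner E) : G.vertex (Corner.across c) = G.vertex c :=
  ((G.vertex_eq_iff _ _).2 (.rel _ _ (.inr rfl))).symm

/-- The boundary steps of `(V(G), A)` that do not run along the edge disc of `e`. -/
def StepAvoiding (A : Set E) (e : E) (c d : Corner E) : Prop :=
  d = G.arc c ∨ (c.1 ≠ e ∧ c.1 ∈ A ∧ d = Corner.side c) ∨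
    (c.1 ≠ e ∧ c.1 ∉ A ∧ d = Corner.across c)

/-- With `card_quot_boundaryStep_insert`, this isolates the effect of `e`: the steps away from `e`
stay the same, and only the matching of its four corners changes. -/
theorem card_quot_boundaryStep_of_notMem {A : Set E} {e : E} (he : e ∉ A) :
    Nat.card (Quot (G.BoundaryStep A)) =
      Nat.card (Quot (addPair (addPair (G.StepAvoiding A e)
        (e, false, false) (e, false, true)) (e, true, false) (e, true, true))) := by
  apply card_quot_congr_eqvGen
  · rintro ⟨e', i, t⟩ d (h | ⟨h, h'⟩ | ⟨h, h'⟩)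
    · exact .rel _ _ (.inl (.inl (.inl h)))
    · exact .rel _ _ (.inl (.inl (.inr (.inl ⟨fun h1 => he (h1 ▸ h), h, h'⟩))))
    · by_cases hee : e' = e
      · subst hee
        subst h'
        have h1 : ∀ i, Relation.EqvGen (addPair (addPair (G.StepAvoiding A e')
            (e', false, false) (e', false, true)) (e', true, false) (e', true, true))
            (e', i, false) (e', i, true) := by
          rintro (_ | _)
          · exact .rel _ _ (.inl (.inr ⟨rfl, rfl⟩))
          · exact .rel _ _ (.inr ⟨rfl, rfl⟩)
        cases t
        · exact h1 i
        · exact (h1 i).symm _ _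
      · exact .rel _ _ (.inl (.inl (.inr (.inr ⟨hee, h, h'⟩))))
  · rintro c d (((h | ⟨_, h⟩ | ⟨_, h⟩) | ⟨rfl, rfl⟩) | ⟨rfl, rfl⟩)
    · exact .rel _ _ (.inl h)
    · exact .rel _ _ (.inr (.inl h))
    · exact .rel _ _ (.inr (.inr h))
    · exact .rel _ _ (.inr (.inr ⟨he, rfl⟩))
    · exact .rel _ _ (.inr (.inr ⟨he, rfl⟩))

theorem card_quot_boundaryStep_insert (A : Set E) (e : E) :
    Nat.card (Quot (G.BoundaryStep (insert e A))) =
      Nat.card (Quot (addPair (addPair (G.StepAvoiding A e)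
        (e, false, false) (e, true, true)) (e, false, true) (e, true, false))) := by
  apply card_quot_congr_eqvGen
  · rintro ⟨e', i, t⟩ d (h | ⟨h, h'⟩ | ⟨h, h'⟩)
    · exact .rel _ _ (.inl (.inl (.inl h)))
    · by_cases hee : e' = e
      · subst hee
        subst h'
        have h1 : ∀ t, Relation.EqvGen (addPair (addPair (G.StepAvoiding A e')
            (e', false, false) (e', true, true)) (e', false, true) (e', true, false))
            (e', false, t) (e', true, !t) := by
          rintro (_ | _)
          · exact .rel _ _ (.inl (.inr ⟨rfl, rfl⟩))
          · exact .rel _ _ (.inr ⟨rfl, rfl⟩)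
        cases i
        · exact h1 t
        · exact .symm _ _ (by simpa [Corner.side] using h1 (!t))
      · exact .rel _ _ (.inl (.inl (.inr (.inl ⟨hee, h.resolve_left hee, h'⟩))))
    · exact .rel _ _ (.inl (.inl (.inr (.inr
        ⟨fun h1 => h (.inl h1), fun h1 => h (.inr h1), h'⟩))))
  · rintro c d (((h | ⟨_, h, h'⟩ | ⟨h, h', h''⟩) | ⟨rfl, rfl⟩) | ⟨rfl, rfl⟩)
    · exact .rel _ _ (.inl h)
    · exact .rel _ _ (.inr (.inl ⟨.inr h, h'⟩))
    · exact .rel _ _ (.inr (.inr ⟨fun h1 => h1.elim h h', h''⟩))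
    · exact .rel _ _ (.inr (.inl ⟨.inl rfl, rfl⟩))
    · exact .rel _ _ (.inr (.inl ⟨.inl rfl, rfl⟩))

theorem c_insert (A : Set E) (e : E) :
    G.c (insert e A) = Nat.card (Quot (addPair (G.Joined A)
      (G.vertex (e, false, false)) (G.vertex (e, true, false)))) := by
  have hv : ∀ e i t, G.vertex (e, i, t) = G.vertex (e, i, false) := by
    rintro e i (_ | _)
    · rfl
    · exact G.vertex_across (e, i, false)
  apply card_quot_congr_eqvGen
  · rintro u w ⟨e', rfl | h, ⟨t, ht⟩, ⟨t', ht'⟩⟩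
    · exact .rel _ _ (.inr ⟨ht ▸ hv _ _ _, ht' ▸ hv _ _ _⟩)
    · exact .rel _ _ (.inl ⟨e', h, ⟨t, ht⟩, ⟨t', ht'⟩⟩)
  · rintro u w (⟨e', h, h'⟩ | ⟨rfl, rfl⟩)
    · exact .rel _ _ ⟨e', .inr h, h'⟩
    · exact .rel _ _ ⟨e, .inl rfl, ⟨_, rfl⟩, ⟨_, rfl⟩⟩

theorem eqvGen_joined_of_stepAvoiding {A : Set E} {e : E} {c d : Corner E}
    (h : Relation.EqvGen (G.StepAvoiding A e) c d) :
    Relation.EqvGen (G.Joined A) (G.vertex c) (G.vertex d) := by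
  induction h with
  | refl x => exact .refl _
  | symm x y _ ih => exact ih.symm _ _
  | trans x y z _ _ ih1 ih2 => exact ih1.trans _ _ _ ih2
  | rel x y h =>
    obtain rfl | ⟨_, h, rfl⟩ | ⟨_, _, rfl⟩ := h
    · rw [G.vertex_arc]; exact .refl _
    · obtain ⟨e', i, t⟩ := x
      cases i
      · exact .rel _ _ ⟨e', h, ⟨_, rfl⟩, ⟨_, rfl⟩⟩
      · exact .symm _ _ (.rel _ _ ⟨e', h, ⟨_, rfl⟩, ⟨_, rfl⟩⟩)
    · rw [G.vertex_across]; exact .refl _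

/-- A class of corners under the steps avoiding `e` contains an even number of corners of `e`. -/
theorem even_card_corners_of_stepAvoiding [Finite E] (A : Set E) (e : E)
    (C : Finset (Corner E))
    (hC : ∀ x y, G.StepAvoiding A e x y → x ∈ C → y ∈ C) [DecidablePred fun x : Corner E => x.1 = e] :
    Even (C.filter fun x => x.1 = e).card := by
  classical
  -- Arcs pair off all of `C`, and sides or arrows pair off the part of `C` away from `e`; the
  -- corners of `e` are the difference.
  have h1 : Even C.card := even_card_of_involutive C G.arc (fun x hx => hC _ _ (.inl rfl) hx)
    (fun x _ => G.arc_arc x) (fun x _ => G.arc_ne x)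
  have h2 : Even (C.filter fun x => ¬ x.1 = e).card := by
    refine even_card_of_involutive _
      (fun x => if x.1 ∈ A then Corner.side x else Corner.across x) ?_ ?_ ?_
    · intro x hx
      rw [Finset.mem_filter] at hx ⊢
      by_cases hA : x.1 ∈ A
      · simp only [hA, if_true]
        exact ⟨hC _ _ (.inr (.inl ⟨hx.2, hA, rfl⟩)) hx.1, hx.2⟩
      · simp only [hA, if_false]
        exact ⟨hC _ _ (.inr (.inr ⟨hx.2, hA, rfl⟩)) hx.1, hx.2⟩
    · rintro ⟨e', i, t⟩ _
      by_cases hA : e' ∈ A <;> simp [hA, Corner.side, Corner.across]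
    · rintro ⟨e', i, t⟩ _
      by_cases hA : e' ∈ A <;> simp [hA, Corner.side, Corner.across]
  rw [← Finset.card_filter_add_card_filter_not (fun x : Corner E => x.1 = e)] at h1
  exact (Nat.even_add.1 h1).2 h2

/-- Otherwise the class of `(e, i, false)` would contain exactly one corner of `e`, since those at
the other end lie in another component; parity forbids this. -/
theorem eqvGen_across_of_not_joined [Finite E] {A : Set E} {e : E} (i : Bool)
    (h : ¬ Relation.EqvGen (G.Joined A)
      (G.vertex (e, i, false)) (G.vertex (e, !i, false))) :
    Relation.EqvGen (G.StepAvoiding A e) (e, i, false) (e, i, true) := by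
  classical
  have := Fintype.ofFinite E
  by_contra hn
  have key := G.even_card_corners_of_stepAvoiding A e
    (Finset.univ.filter fun x => Relation.EqvGen (G.StepAvoiding A e) (e, i, false) x)
    (fun x y hxy hx => by
      simp only [Finset.mem_filter, Finset.mem_univ, true_and] at hx ⊢
      exact hx.trans _ _ _ (.rel _ _ hxy))
  have hs : ((Finset.univ.filter fun x =>
      Relation.EqvGen (G.StepAvoiding A e) (e, i, false) x).filter fun x => x.1 = e) =
      {(e, i, false)} := by
    ext ⟨e', j, t⟩
    simp only [Finset.mem_filter, Finset.mem_univ, true_and, Finset.mem_singleton]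
    constructor
    · rintro ⟨hx, rfl⟩
      by_cases hj : j = i
      · subst hj
        cases t
        · rfl
        · exact absurd hx hn
      · obtain rfl : j = !i := by cases i <;> cases j <;> simp_all
        refine absurd (G.eqvGen_joined_of_stepAvoiding hx) ?_
        cases t
        · exact h
        · rwa [show ((e', !i, true) : Corner E) = Corner.across (e', !i, false) from rfl,
            G.vertex_across]
    · rintro ⟨⟩
      exact ⟨.refl _, rfl⟩
  rw [hs] at key
  simp at key

/-! ### Bounds on rank and Euler genus -/

theorem f_eq [Finite V] [Finite E] (A : Set E) :
    G.f A = Nat.card (Quot (G.BoundaryStep A)) + Nat.card {v : V // ∀ c, G.vertex c ≠ v} :=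
  Nat.card_sum

theorem c_empty : G.c ∅ = G.v :=
  Nat.card_congr
    { toFun := Quot.lift id (by rintro u w ⟨e, h, _⟩; exact absurd h (Set.notMem_empty e))
      invFun := Quot.mk _
      left_inv := by rintro ⟨x⟩; rfl
      right_inv := fun _ => rfl }

theorem f_empty [Finite V] [Finite E] : G.f ∅ = G.v := by
  classical
  have hstep : G.BoundaryStep ∅ = fun x y => y = G.arc x ∨ y = Corner.across x := by
    ext x y
    simp [BoundaryStep]
  rw [f_eq, v, ← Nat.card_congr (Equiv.sumCompl fun v : V => ∃ c, G.vertex c = v), Nat.card_sum]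
  congr 1
  · refine Nat.card_congr (Equiv.ofBijective
      (Quot.lift (fun c => ⟨G.vertex c, c, rfl⟩) fun x y h => Subtype.ext ?_) ⟨?_, ?_⟩)
    · rw [hstep] at h
      exact (G.vertex_eq_iff _ _).2 (.rel _ _ h)
    · rintro ⟨x⟩ ⟨y⟩ h
      refine Quot.eqvGen_sound ?_
      rw [hstep]
      exact (G.vertex_eq_iff _ _).1 (congrArg Subtype.val h)
    · rintro ⟨_, c, rfl⟩
      exact ⟨Quot.mk _ c, rfl⟩
  · exact Nat.card_congr (Equiv.subtypeEquivRight fun v => not_exists.symm)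

/-- A spanning subgraph has rank at most its number of edges, and its Euler genus is nonnegative. -/
theorem v_le_and_v_add_f_le [Finite V] [Finite E] (A : Finset E) :
    G.v ≤ G.c (A : Set E) + A.card ∧
      G.v + G.f (A : Set E) ≤ 2 * G.c (A : Set E) + A.card := by
  classical
  induction A using Finset.induction_on with
  | empty => simp only [Finset.coe_empty, c_empty, f_empty]; simp; omega
  | insert e A he ih =>
    obtain ⟨ih1, ih2⟩ := ih
    have he' : e ∉ (A : Set E) := by simpa using he
    rw [Finset.coe_insert, Finset.card_insert_of_notMem he, G.c_insert, f_eq,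
      G.card_quot_boundaryStep_insert]
    rw [f_eq, G.card_quot_boundaryStep_of_notMem he'] at ih2
    rw [c] at ih1 ih2
    by_cases h : Relation.EqvGen (G.Joined A)
        (G.vertex (e, false, false)) (G.vertex (e, true, false))
    · rw [card_quot_addPair_of_eqvGen h]
      have := card_quot_rematch_le (G.StepAvoiding A e)
        (e, false, false) (e, false, true) (e, true, false) (e, true, true)
      omega
    · have hc := card_quot_addPair_add_one h
      have h1 := G.eqvGen_across_of_not_joined false h
      have h2 := G.eqvGen_across_of_not_joined true fun h' => h (h'.symm _ _)
      rw [card_quot_addPair_of_eqvGen (eqvGen_addPair _ _ h2),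
        card_quot_addPair_of_eqvGen h1] at ih2
      -- Before insertion both pairs are redundant; after it, the first side merges the classes at
      -- the two ends of `e`.
      have h3 : ¬ Relation.EqvGen (G.StepAvoiding A e) (e, false, false) (e, true, true) :=
        fun h' => h (G.eqvGen_joined_of_stepAvoiding (h'.trans _ _ _ (h2.symm _ _)))
      have h4 := card_quot_addPair_add_one h3
      have h5 := card_quot_addPair_le (addPair (G.StepAvoiding A e)
        (e, false, false) (e, true, true)) (e, false, true) (e, true, false)
      omega

theorem c_le_v [Finite V] (A : Set E) : G.c A ≤ G.v :=
  Nat.card_le_card_of_surjective (Quot.mk _) Quot.mk_surjective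

theorem c_anti [Finite V] {A B : Set E} (h : A ⊆ B) : G.c B ≤ G.c A :=
  Nat.card_le_card_of_surjective
    (Quot.map id fun _ _ ⟨e, he, h'⟩ => ⟨e, h he, h'⟩)
    (Quot.ind fun x => ⟨Quot.mk _ x, rfl⟩)

/-! ### Boundary components of twisted duals -/

/-- The name in `G^×` of a corner of `(G^*)^{τ(A)}`. -/
noncomputable def relabelDual (A : Set E) : Equiv.Perm (Corner E) :=
  (Corner.flip A).trans ((Corner.rotate E).trans (Corner.flip Set.univ).symm)

open Classical in
theorem relabelDual_apply (A : Set E) (e : E) (i t : Bool) :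
    relabelDual A (e, i, t) =
      (e, xor i (xor t (decide (e ∈ A) && i)),
        xor (!xor t (decide (e ∈ A) && i)) (xor i (xor t (decide (e ∈ A) && i)))) := by
  rw [relabelDual, Equiv.trans_apply, Equiv.trans_apply, Equiv.symm_apply_eq]
  by_cases h : e ∈ A <;> cases i <;> cases t <;>
    simp [Corner.flip, Corner.rotate, Corner.across, h]

/-- The boundary components of `G^*` with half-twists along `A` are those of the spanning ribbon
subgraph `(V(G), A)` of the Petrie dual of `G`. -/
theorem f_partialPetrial_dual [Finite V] [Finite E] (A : Set E) :
    (G.dual.partialPetrial A).f Set.univ = G.petrial.f A := by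
  classical
  rw [f, f, Nat.card_sum, Nat.card_sum]
  congr 1
  · refine Nat.card_congr (Quot.congr
      (relabelDual A) ?_)
    intro x y
    have hfst : (relabelDual A x).1 = x.1 := by
      obtain ⟨e, i, t⟩ := x
      by_cases h : e ∈ A <;> cases i <;> simp [relabelDual_apply, h]
    have hside : x.1 ∈ A → relabelDual A (Corner.side x) = Corner.side (relabelDual A x) := by
      obtain ⟨e, i, t⟩ := x
      intro h
      cases i <;> cases t <;> simp_all [relabelDual_apply, Corner.side]
    have hacross : x.1 ∉ A → relabelDual A (Corner.side x) = Corner.across (relabelDual A x) := by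
      obtain ⟨e, i, t⟩ := x
      intro h
      cases i <;> cases t <;> simp_all [relabelDual_apply, Corner.across, Corner.side]
    have harc : (G.dual.partialPetrial A).arc x =
        (relabelDual A).symm (G.petrial.arc (relabelDual A x)) := by
      simp [relabelDual, petrial, partialPetrial, dual]
    rw [BoundaryStep, BoundaryStep, hfst, harc, Equiv.eq_symm_apply]
    refine or_congr_right ?_
    by_cases h : x.1 ∈ A
    · simp [h, ← hside h]
    · simp [h, ← hacross h]
  -- Circles without arrows correspond: a dual vertex arising from a class of corners always carries
  -- an arrow.
  · refine Nat.card_congr (Equiv.ofBijective (fun w => ?_) ⟨?_, ?_⟩).symm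
    · exact ⟨Sum.inr ⟨w.1, fun c hc => w.2 ((Corner.flip Set.univ).symm c)
        (by simpa [petrial, partialPetrial] using hc)⟩, fun c hc => by
          simp [partialPetrial, dual] at hc⟩
    · rintro ⟨w, hw⟩ ⟨w', hw'⟩ h
      simpa using h
    · rintro ⟨⟨⟨c⟩⟩ | ⟨w, hw⟩, h⟩
      · refine absurd ?_ (h ((Corner.flip A).symm ((Corner.rotate E).symm c)))
        simp [partialPetrial, dual]
      · exact ⟨⟨w, fun c hc => hw _ hc⟩, rfl⟩

end EmbeddedGraph

/-! ### Comparison of monomials -/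

theorem theorem4p6 {V E S : Type*} [Finite V] [Fintype E] [CommRing S]
    (G : EmbeddedGraph V E) (l : Sˣ) :
    Polynomial.aeval (l : S) G.dual.penrose =
      (l : S) ^ G.petrial.c Set.univ * (-1) ^ G.petrial.r Set.univ *
        MvPolynomial.aeval ![1 - (l : S), -(l : S), ((l⁻¹ : Sˣ) : S)]
          G.petrial.ribbonGraphPolynomial := by
  simp only [EmbeddedGraph.penrose, EmbeddedGraph.ribbonGraphPolynomial, map_sum, Finset.mul_sum,
    EmbeddedGraph.f_partialPetrial_dual]
  refine Finset.sum_congr rfl fun A _ => ?_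
  obtain ⟨h1, h2⟩ := G.petrial.v_le_and_v_add_f_le A
  have h3 := G.petrial.c_le_v (A : Set E)
  have h4 := G.petrial.c_anti (Set.subset_univ (A : Set E))
  simp only [map_mul, map_pow, map_neg, map_one, map_sub, Polynomial.aeval_X, MvPolynomial.aeval_X,
    EmbeddedGraph.n, EmbeddedGraph.r, Set.ncard_coe_finset, Matrix.cons_val_zero,
    Matrix.cons_val_one, Matrix.cons_val]
  generalize G.petrial.f (A : Set E) = f at *
  generalize G.petrial.c (A : Set E) = c at *
  generalize G.petrial.c Set.univ = c₀ at *
  generalize G.petrial.v = v at *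
  generalize A.card = a at *
  obtain ⟨r, rfl⟩ := Nat.exists_eq_add_of_le h3
  obtain ⟨k, rfl⟩ := Nat.exists_eq_add_of_le h4
  -- For the subgraph `A` of `G^×`, `r` is the rank, `k` the rank deficit `r(G^×) - r(A)`, `n` the
  -- nullity, and `g` the Euler genus.
  obtain ⟨n, rfl⟩ := Nat.exists_eq_add_of_le (show r ≤ a by omega)
  obtain ⟨g, hg⟩ := Nat.exists_eq_add_of_le (show f ≤ c₀ + k + n by omega)
  rw [show c₀ + k + r - c₀ = k + r by omega, show c₀ + k + r - (c₀ + k) = r by omega,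
    show r + n - r = n by omega, show k + r - r = k by omega,
    show c₀ + k + n - f = g by omega, sub_sub_cancel_left, neg_pow (l : S) k, neg_pow (l : S) n]
  -- The sign `(-1)^k` occurs twice, in `(-1)^(k + r)` and in `(-λ)^k`, and cancels.
  have hs : ((-1 : S) ^ k) * (-1) ^ k = 1 := by rw [← mul_pow]; simp
  have hl : (l : S) ^ c₀ * (l : S) ^ k * (l : S) ^ n * ((l⁻¹ : Sˣ) : S) ^ g = (l : S) ^ f := by
    rw [← pow_add, ← pow_add, hg, pow_add, mul_assoc, ← mul_pow, Units.mul_inv, one_pow, mul_one]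
  rw [← hl, pow_add, pow_add]
  linear_combination (-((-1 : S) ^ r * (-1) ^ n * ((l : S) ^ c₀ * (l : S) ^ k * (l : S) ^ n * ((l⁻¹ : Sˣ) : S) ^ g))) * hs
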